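/- Let $\mathbb{K}$ be the digital line, that is, $\mathbb{Z}$ with the (Khalimsky) topology generated by the sets $N(n)=\{n\}$ for $n$ odd and $N(n)=\{n-1,n,n+1\}$ for $n$ even, and let $\mathbb{K}^2$ carry the product topology. A point $(x,y)\in\mathbb{K}^2$ is pure if $x$ and $y$ are both even or both odd. Two distinct points $p,q$ are adjacent if $\{p,q\}$ is connected, and a point is adjacent to a set if it is adjacent to some point of that set. An arc is a subset that, with the subspace topology, is homeomorphic to a nonempty finite interval $\{a,a+1,\dots,b\}$ of $\mathbb{K}$. A Jordan curve is a connected set $J$ with $|J|\ge 4$ such that $J\setminus\{p\}$ is an arc for every $p\in J$. Theorem. If $J\subseteq\mathbb{K}^2$ is a Jordan curve with $|J|>4$, all of whose points are pure, then $\mathbb{K}^2\setminus J$ has exactly two connected components. Moreover, every point of $J$ is adjacent to both components of $\mathbb{K}^2\setminus J$. -/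

import Mathlib

/-- The underlying set `ℤ` of the digital line (a type synonym, so that it does not inherit
the discrete topology of `ℤ`). -/
def DigitalLine : Type := ℤ

namespace DigitalLine

/-- The identity map, viewing an integer as a point of the digital line. -/
def ofInt : ℤ ≃ DigitalLine := Equiv.refl ℤ

/-- The identity map, viewing a point of the digital line as an integer. -/
def toInt : DigitalLine ≃ ℤ := ofInt.symm

/-- The generating set `N(n)`: it is `{n}` if `n` is odd and `{n - 1, n, n + 1}` if `n` is even. -/
def basicNhd (n : ℤ) : Set DigitalLine :=
  {m | (Odd n ∧ toInt m = n) ∨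
    (Even n ∧ (toInt m = n - 1 ∨ toInt m = n ∨ toInt m = n + 1))}

/-- The Khalimsky topology, generated by the sets `N(n)`. -/
instance : TopologicalSpace DigitalLine :=
  TopologicalSpace.generateFrom (Set.range basicNhd)

/-- The finite interval `{a, a + 1, …, b}` of the digital line. -/
def interval (a b : ℤ) : Set DigitalLine :=
  {m | a ≤ toInt m ∧ toInt m ≤ b}

end DigitalLine

/-- The digital plane, with the product topology. -/
abbrev DigitalPlane : Type := DigitalLine × DigitalLine

namespace DigitalTopology

/-- A point of the digital plane is pure if its coordinates are both even or both odd. -/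
def IsPure (p : DigitalPlane) : Prop :=
  (Even (DigitalLine.toInt p.1) ∧ Even (DigitalLine.toInt p.2)) ∨
    (Odd (DigitalLine.toInt p.1) ∧ Odd (DigitalLine.toInt p.2))

/-- The adjacency `A(x)` of a point: all `y ≠ x` such that `{x, y}` is connected. -/
def adjacency {X : Type*} [TopologicalSpace X] (x : X) : Set X :=
  {y | y ≠ x ∧ IsConnected ({x, y} : Set X)}

/-- A point is adjacent to a set if it is adjacent to some point of the set. -/
def AdjacentToSet {X : Type*} [TopologicalSpace X] (x : X) (S : Set X) : Prop :=
  ∃ y ∈ S, y ∈ adjacency x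

/-- An arc: a subset that, with the subspace topology, is homeomorphic to a (nonempty) finite
interval of the digital line. -/
def IsArc {X : Type*} [TopologicalSpace X] (C : Set X) : Prop :=
  ∃ a b : ℤ, a ≤ b ∧ Nonempty (DigitalLine.interval a b ≃ₜ C)

/-- A Jordan curve: a connected set `J` with at least four points such that removing any
point of `J` leaves an arc. -/
structure IsJordanCurve {X : Type*} [TopologicalSpace X] (J : Set X) : Prop where
  isConnected : IsConnected J
  four_le_encard : 4 ≤ J.encard
  isArc_diff : ∀ x ∈ J, IsArc (J \ {x})

/-- The set of connected components of the subspace `S`. -/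
def components {X : Type*} [TopologicalSpace X] (S : Set X) : Set (Set X) :=
  {C | ∃ x ∈ S, C = connectedComponentIn S x}

end DigitalTopology

/-! ### Smallest neighbourhoods in the digital line and the digital plane -/

namespace DigitalLine

/-! A curve of pure points moves only diagonally, and each of its points has exactly two neighbours
on it (`IsJordanCurve.sum_chi_eq_two`). The other two corners of the unit square around an edge are
mixed, hence off `J`.

At most two components: around a point of `J`, its two curve neighbours cut the ring of eight
neighbours into two chains, each containing one mixed point beside any given edge. So the components
touching an end of an edge are those of these two mixed points, the same for both ends
(`IsJordanCurve.adjacentToSet_iff`). As `J` is connected, all its points touch the same components;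
as the plane is connected, every component touches `J`.

At least two: a mod 2 function on the mixed points that changes exactly across edges of `J` is
obtained by counting edges crossed along one diagonal direction. It obeys the same rule in the other
direction because every point of `J` has even degree (`IsJordanCurve.exists_parity`). Extended to
pure points off `J`, it is constant on components, yet differs on the two sides of an edge. -/

theorem mem_basicNhd_ofInt {n m : ℤ} :
    ofInt m ∈ basicNhd n ↔ (Odd n ∧ m = n) ∨ (Even n ∧ (m = n - 1 ∨ m = n ∨ m = n + 1)) :=
  Iff.rfl

theorem isOpen_basicNhd (n : ℤ) : IsOpen (basicNhd n) :=
  TopologicalSpace.isOpen_generateFrom_of_mem ⟨n, rfl⟩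

theorem self_mem_basicNhd (n : ℤ) : ofInt n ∈ basicNhd n := by
  rw [mem_basicNhd_ofInt]
  rcases Int.even_or_odd n with h | h
  · exact Or.inr ⟨h, Or.inr (Or.inl rfl)⟩
  · exact Or.inl ⟨h, rfl⟩

theorem specializes_of_mem_basicNhd {n m : ℤ} (h : ofInt m ∈ basicNhd n) :
    ofInt m ⤳ ofInt n := by
  have key : ∀ k, ofInt n ∈ basicNhd k → ofInt m ∈ basicNhd k := by
    intro k hk
    rw [mem_basicNhd_ofInt] at *
    grind
  rw [Specializes, TopologicalSpace.nhds_generateFrom, TopologicalSpace.nhds_generateFrom]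
  refine le_iInf₂ fun s hs => ?_
  obtain ⟨hns, k, rfl⟩ := hs
  exact iInf₂_le_of_le _ ⟨key k hns, k, rfl⟩ le_rfl

theorem finite_interval (a b : ℤ) : (interval a b).Finite :=
  Set.finite_Icc a b

end DigitalLine

namespace DigitalTopology

open DigitalLine

/-- The point of the digital plane with given integer coordinates. -/
def pt (a b : ℤ) : DigitalPlane := (ofInt a, ofInt b)

theorem exists_eq_pt (p : DigitalPlane) : ∃ a b, p = pt a b :=
  ⟨toInt p.1, toInt p.2, rfl⟩

theorem pt_inj {a b c d : ℤ} : pt a b = pt c d ↔ a = c ∧ b = d :=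
  Prod.mk_inj

/-- The smallest neighbourhood of a point of the digital plane. -/
def minNhd (p : DigitalPlane) : Set DigitalPlane :=
  basicNhd (toInt p.1) ×ˢ basicNhd (toInt p.2)

theorem mem_minNhd_pt {a b c d : ℤ} : pt c d ∈ minNhd (pt a b) ↔
    ((Odd a ∧ c = a) ∨ (Even a ∧ (c = a - 1 ∨ c = a ∨ c = a + 1))) ∧
    ((Odd b ∧ d = b) ∨ (Even b ∧ (d = b - 1 ∨ d = b ∨ d = b + 1))) :=
  Iff.rfl

theorem isOpen_minNhd (p : DigitalPlane) : IsOpen (minNhd p) :=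
  (isOpen_basicNhd _).prod (isOpen_basicNhd _)

theorem self_mem_minNhd (p : DigitalPlane) : p ∈ minNhd p :=
  ⟨self_mem_basicNhd _, self_mem_basicNhd _⟩

theorem specializes_of_mem_minNhd {p q : DigitalPlane} (h : q ∈ minNhd p) : q ⤳ p :=
  (specializes_of_mem_basicNhd h.1).prod (specializes_of_mem_basicNhd h.2)

/-! ### Adjacency and connectedness in general spaces -/

section General

variable {X Y : Type*} [TopologicalSpace X] [TopologicalSpace Y]

theorem isConnected_pair_of_specializes {x y : X} (h : x ⤳ y) :
    IsConnected ({x, y} : Set X) := by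
  refine (isConnected_singleton (x := x)).subset_closure (Set.singleton_subset_iff.2 (by simp)) ?_
  rintro z (rfl | rfl)
  · exact subset_closure rfl
  · exact specializes_iff_mem_closure.1 h

/-- A property that is locally constant on a preconnected set, as witnessed by a system of open
neighbourhoods, is constant on it. -/
theorem iff_of_isPreconnected {S : Set X} (hS : IsPreconnected S) {U : X → Set X}
    (hU : ∀ x, IsOpen (U x)) (hmem : ∀ x, x ∈ U x) {P : X → Prop}
    (h : ∀ x ∈ S, ∀ y ∈ S, y ∈ U x → (P x ↔ P y)) {x y : X} (hx : x ∈ S) (hy : y ∈ S) :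
    P x ↔ P y := by
  by_contra hxy
  wlog hP : P x generalizing x y
  · exact this hy hx (by tauto) (by tauto)
  have hPy : ¬ P y := by tauto
  obtain ⟨z, hzS, hz₁, hz₂⟩ := hS (⋃ w ∈ {w | w ∈ S ∧ P w}, U w) (⋃ w ∈ {w | w ∈ S ∧ ¬ P w}, U w)
    (isOpen_biUnion fun w _ => hU w) (isOpen_biUnion fun w _ => hU w)
    (fun w hw => by
      by_cases hPw : P w
      · exact Or.inl (Set.mem_biUnion (show w ∈ {w | w ∈ S ∧ P w} from ⟨hw, hPw⟩) (hmem w))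
      · exact Or.inr (Set.mem_biUnion (show w ∈ {w | w ∈ S ∧ ¬ P w} from ⟨hw, hPw⟩) (hmem w)))
    ⟨x, hx, Set.mem_biUnion (show x ∈ {w | w ∈ S ∧ P w} from ⟨hx, hP⟩) (hmem x)⟩
    ⟨y, hy, Set.mem_biUnion (show y ∈ {w | w ∈ S ∧ ¬ P w} from ⟨hy, hPy⟩) (hmem y)⟩
  simp only [Set.mem_iUnion, Set.mem_ofPred_eq] at hz₁ hz₂
  obtain ⟨u, ⟨hu, hPu⟩, hzu⟩ := hz₁
  obtain ⟨v, ⟨hv, hPv⟩, hzv⟩ := hz₂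
  exact hPv ((h v hv z hzS hzv).2 ((h u hu z hzS hzu).1 hPu))

theorem mem_or_mem_of_mem_adjacency {U : X → Set X} (hU : ∀ x, IsOpen (U x))
    (hmem : ∀ x, x ∈ U x) {x y : X} (h : y ∈ adjacency x) : y ∈ U x ∨ x ∈ U y := by
  by_contra! hxy
  have := iff_of_isPreconnected (P := fun z => z = x) h.2.isPreconnected hU hmem
    (by
      rintro u (rfl | rfl) v (rfl | rfl) huv
      · rfl
      · exact absurd huv hxy.1
      · exact absurd huv hxy.2
      · rfl) (x := x) (y := y) (by simp) (by simp)
  exact h.1 (this.1 rfl)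

theorem adjacency_comm {x y : X} : y ∈ adjacency x ↔ x ∈ adjacency y := by
  simp only [adjacency, Set.mem_ofPred_eq, Set.pair_comm x y, ne_comm]

/-- A homeomorphism between subspaces preserves adjacency. -/
theorem homeomorph_mem_adjacency {S : Set X} {T : Set Y} (e : S ≃ₜ T) {x y : S}
    (h : (y : X) ∈ adjacency (x : X)) : (e y : Y) ∈ adjacency (e x : Y) := by
  refine ⟨fun he => h.1 (congrArg _ (e.injective (Subtype.ext he))), by simp, ?_⟩
  have h₁ : IsPreconnected ({x, y} : Set S) := by
    rw [← Topology.IsInducing.subtypeVal.isPreconnected_image, Set.image_pair]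
    exact h.2.isPreconnected
  have h₂ := h₁.image (fun z => (e z : Y)) (continuous_subtype_val.comp e.continuous).continuousOn
  rwa [Set.image_pair] at h₂

theorem connectedComponentIn_eq_of_mem_adjacency {S : Set X} {x y : X} (hx : x ∈ S) (hy : y ∈ S)
    (h : y ∈ adjacency x) : connectedComponentIn S x = connectedComponentIn S y := by
  apply connectedComponentIn_eq
  refine h.2.isPreconnected.subset_connectedComponentIn (by simp) ?_ (by simp)
  rintro z (rfl | rfl) <;> assumption

end General

theorem mem_adjacency_digitalLine {m n : ℤ} :
    ofInt m ∈ adjacency (ofInt n) ↔ m = n - 1 ∨ m = n + 1 := by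
  constructor
  · intro h
    have hne : m ≠ n := fun he => h.1 (he ▸ rfl)
    have := mem_or_mem_of_mem_adjacency (U := fun x => basicNhd (toInt x))
      (fun x => isOpen_basicNhd _) (fun x => self_mem_basicNhd _) h
    change ofInt m ∈ basicNhd n ∨ ofInt n ∈ basicNhd m at this
    simp only [mem_basicNhd_ofInt] at this
    omega
  · intro h
    refine ⟨fun he => ?_, ?_⟩
    · have : m = n := he
      omega
    · rcases Int.even_or_odd n with hn | hn
      · rw [Set.pair_comm]
        exact isConnected_pair_of_specializes (specializes_of_mem_basicNhd
          (mem_basicNhd_ofInt.2 (Or.inr ⟨hn, by omega⟩)))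
      · refine isConnected_pair_of_specializes (specializes_of_mem_basicNhd
          (mem_basicNhd_ofInt.2 (Or.inr ⟨?_, by omega⟩)))
        grind

theorem mem_adjacency_iff {p q : DigitalPlane} :
    q ∈ adjacency p ↔ q ≠ p ∧ (q ∈ minNhd p ∨ p ∈ minNhd q) := by
  constructor
  · intro h
    exact ⟨h.1, mem_or_mem_of_mem_adjacency isOpen_minNhd self_mem_minNhd h⟩
  · rintro ⟨hne, h | h⟩
    · exact ⟨hne, by
        rw [Set.pair_comm]
        exact isConnected_pair_of_specializes (specializes_of_mem_minNhd h)⟩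
    · exact ⟨hne, isConnected_pair_of_specializes (specializes_of_mem_minNhd h)⟩

/-- Adjacency in coordinates: pure points have eight neighbours, the others four. -/
theorem pt_mem_adjacency_iff {a b c d : ℤ} : pt c d ∈ adjacency (pt a b) ↔
    (c = a ∧ (d = b - 1 ∨ d = b + 1)) ∨ (d = b ∧ (c = a - 1 ∨ c = a + 1)) ∨
      (Even (a + b) ∧ (c = a - 1 ∨ c = a + 1) ∧ (d = b - 1 ∨ d = b + 1)) := by
  rw [mem_adjacency_iff, Ne, pt_inj, mem_minNhd_pt, mem_minNhd_pt]
  simp only [Int.even_iff, Int.odd_iff]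
  omega

end DigitalTopology

namespace DigitalTopology

open DigitalLine

/-! ### Local structure of arcs and Jordan curves -/

theorem exists_mem_notMem_finset {X : Type*} {J : Set X} {s : Finset X} (h : (s.card : ℕ∞) < J.encard) :
    ∃ x ∈ J, x ∉ s := by
  by_contra! hs
  have : J.encard ≤ (s : Set X).encard := Set.encard_le_encard hs
  rw [Set.encard_coe_eq_coe_finsetCard] at this
  exact absurd h (not_lt.2 this)

section General

variable {X : Type*} [TopologicalSpace X]

theorem IsArc.finite {C : Set X} (hC : IsArc C) : C.Finite := by
  obtain ⟨a, b, -, ⟨e⟩⟩ := hC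
  have := (finite_interval a b).to_subtype
  have : Finite C := Finite.of_equiv _ e.toEquiv
  exact Set.toFinite C

theorem IsArc.exists_mem_adjacency {C : Set X} (hC : IsArc C) {p q : X} (hp : p ∈ C) (hq : q ∈ C)
    (hpq : q ≠ p) : ∃ r ∈ C, r ∈ adjacency p := by
  obtain ⟨a, b, -, ⟨e⟩⟩ := hC
  obtain ⟨⟨m, hm⟩, hem⟩ := e.surjective ⟨p, hp⟩
  obtain ⟨⟨n, hn⟩, hen⟩ := e.surjective ⟨q, hq⟩
  have hmn : toInt n ≠ toInt m := by
    intro h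
    obtain rfl : n = m := h
    exact hpq (congrArg Subtype.val (hen.symm.trans hem))
  obtain ⟨k, hk, hkm⟩ : ∃ k : ℤ, ofInt k ∈ interval a b ∧ ofInt k ∈ adjacency (ofInt (toInt m)) := by
    simp only [mem_adjacency_digitalLine]
    have h₁ : a ≤ toInt m ∧ toInt m ≤ b := hm
    have h₂ : a ≤ toInt n ∧ toInt n ≤ b := hn
    rcases lt_or_gt_of_ne hmn with h | h
    · exact ⟨toInt m - 1, show a ≤ toInt m - 1 ∧ toInt m - 1 ≤ b by omega, Or.inl rfl⟩
    · exact ⟨toInt m + 1, show a ≤ toInt m + 1 ∧ toInt m + 1 ≤ b by omega, Or.inr rfl⟩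
  have := homeomorph_mem_adjacency e (x := ⟨m, hm⟩) (y := ⟨ofInt k, hk⟩) hkm
  rw [hem] at this
  exact ⟨_, (e ⟨ofInt k, hk⟩).2, this⟩

theorem IsArc.eq_or_eq_of_mem_adjacency {C : Set X} (hC : IsArc C) {p q₁ q₂ q₃ : X} (hp : p ∈ C)
    (hq₁ : q₁ ∈ C) (hq₂ : q₂ ∈ C) (hq₃ : q₃ ∈ C) (h₁ : q₁ ∈ adjacency p) (h₂ : q₂ ∈ adjacency p)
    (h₃ : q₃ ∈ adjacency p) : q₁ = q₂ ∨ q₁ = q₃ ∨ q₂ = q₃ := by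
  obtain ⟨a, b, -, ⟨e⟩⟩ := hC
  have key : ∀ q (hq : q ∈ C), q ∈ adjacency p →
      toInt (e.symm ⟨q, hq⟩ : DigitalLine) = toInt (e.symm ⟨p, hp⟩ : DigitalLine) - 1 ∨
      toInt (e.symm ⟨q, hq⟩ : DigitalLine) = toInt (e.symm ⟨p, hp⟩ : DigitalLine) + 1 := by
    intro q hq h
    exact mem_adjacency_digitalLine.1
      (homeomorph_mem_adjacency e.symm (x := ⟨p, hp⟩) (y := ⟨q, hq⟩) h)
  have inj : ∀ q (hq : q ∈ C) r (hr : r ∈ C),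
      toInt (e.symm ⟨q, hq⟩ : DigitalLine) = toInt (e.symm ⟨r, hr⟩ : DigitalLine) → q = r := by
    intro q hq r hr h
    exact congrArg Subtype.val (e.symm.injective (Subtype.ext (toInt.injective h)))
  have k₁ := key q₁ hq₁ h₁
  have k₂ := key q₂ hq₂ h₂
  have k₃ := key q₃ hq₃ h₃
  have i₁ := inj q₁ hq₁ q₂ hq₂
  have i₂ := inj q₁ hq₁ q₃ hq₃
  have i₃ := inj q₂ hq₂ q₃ hq₃
  grind

theorem IsJordanCurve.finite {J : Set X} (hJ : IsJordanCurve J) : J.Finite := by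
  obtain ⟨x, hx⟩ := hJ.isConnected.nonempty
  have := (hJ.isArc_diff x hx).finite.insert x
  rwa [Set.insert_sdiff_singleton, Set.insert_eq_of_mem hx] at this

theorem IsJordanCurve.exists_mem_adjacency_ne {J : Set X} (hJ : IsJordanCurve J) {p x : X}
    (hp : p ∈ J) (hx : x ∈ J) (hpx : p ≠ x) : ∃ r ∈ J, r ≠ x ∧ r ∈ adjacency p := by
  classical
  have hcard : ((({p, x} : Finset X).card : ℕ) : ℕ∞) < J.encard := by
    refine lt_of_lt_of_le ?_ hJ.four_le_encard
    refine lt_of_le_of_lt (b := ((2 : ℕ) : ℕ∞)) (Nat.cast_le.2 Finset.card_le_two) ?_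
    exact_mod_cast (by norm_num : 2 < 4)
  obtain ⟨q, hq, hqs⟩ := exists_mem_notMem_finset hcard
  simp only [Finset.mem_insert, Finset.mem_singleton, not_or] at hqs
  obtain ⟨r, hr, hrp⟩ := (hJ.isArc_diff x hx).exists_mem_adjacency (p := p) (q := q)
    ⟨hp, hpx⟩ ⟨hq, hqs.2⟩ hqs.1
  exact ⟨r, hr.1, hr.2, hrp⟩

/-- Every point of a Jordan curve has two neighbours on the curve. -/
theorem IsJordanCurve.exists_two_neighbors {J : Set X} (hJ : IsJordanCurve J) {p : X}
    (hp : p ∈ J) : ∃ q ∈ J, ∃ r ∈ J, q ≠ r ∧ q ∈ adjacency p ∧ r ∈ adjacency p := by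
  obtain ⟨x, hx, hxp⟩ := exists_mem_notMem_finset (J := J) (s := {p})
    (lt_of_lt_of_le (by simp) hJ.four_le_encard)
  obtain ⟨q, hq, -, hqp⟩ := hJ.exists_mem_adjacency_ne hp hx (by simpa [eq_comm] using hxp)
  -- Deleting the first neighbour forces a second one.
  obtain ⟨r, hr, hrq, hrp⟩ := hJ.exists_mem_adjacency_ne hp hq hqp.1.symm
  exact ⟨q, hq, r, hr, hrq.symm, hqp, hrp⟩

/-- A point of a Jordan curve with more than four points has no three neighbours on the curve. -/
theorem IsJordanCurve.eq_or_eq_of_mem_adjacency {J : Set X} (hJ : IsJordanCurve J)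
    (hcard : 4 < J.encard) {p q₁ q₂ q₃ : X} (hp : p ∈ J)
    (hq₁ : q₁ ∈ J) (hq₂ : q₂ ∈ J) (hq₃ : q₃ ∈ J) (h₁ : q₁ ∈ adjacency p) (h₂ : q₂ ∈ adjacency p)
    (h₃ : q₃ ∈ adjacency p) : q₁ = q₂ ∨ q₁ = q₃ ∨ q₂ = q₃ := by
  classical
  -- A fifth point can be deleted while keeping `p` and its three neighbours, which then lie in one
  -- arc.
  obtain ⟨x, hx, hxs⟩ := exists_mem_notMem_finset (J := J) (s := {p, q₁, q₂, q₃})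
    (lt_of_le_of_lt (b := ((4 : ℕ) : ℕ∞)) (Nat.cast_le.2 Finset.card_le_four) hcard)
  simp only [Finset.mem_insert, Finset.mem_singleton, not_or] at hxs
  obtain ⟨n, n₁, n₂, n₃⟩ := hxs
  exact (hJ.isArc_diff x hx).eq_or_eq_of_mem_adjacency ⟨hp, Ne.symm n⟩ ⟨hq₁, Ne.symm n₁⟩
    ⟨hq₂, Ne.symm n₂⟩ ⟨hq₃, Ne.symm n₃⟩ h₁ h₂ h₃

end General

/-! ### Pure Jordan curves in coordinates -/

/-- The indicator function of a set of points of the digital plane. -/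
noncomputable def chi (J : Set DigitalPlane) (a b : ℤ) : ℕ :=
  open scoped Classical in if pt a b ∈ J then 1 else 0

theorem chi_of_mem {J : Set DigitalPlane} {a b : ℤ} (h : pt a b ∈ J) : chi J a b = 1 :=
  if_pos h

theorem chi_of_notMem {J : Set DigitalPlane} {a b : ℤ} (h : pt a b ∉ J) : chi J a b = 0 :=
  if_neg h

theorem even_add_of_isPure {a b : ℤ} (h : IsPure (pt a b)) : Even (a + b) := by
  change (Even a ∧ Even b) ∨ (Odd a ∧ Odd b) at h
  grind

/-- Horizontal and vertical neighbours of a pure point are mixed, so both curve neighbours are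
diagonal. -/
theorem IsJordanCurve.sum_chi_eq_two {J : Set DigitalPlane} (hJ : IsJordanCurve J)
    (hpure : ∀ p ∈ J, IsPure p) (hcard : 4 < J.encard) {a b : ℤ} (h : pt a b ∈ J) :
    chi J (a + 1) (b + 1) + chi J (a + 1) (b - 1) + chi J (a - 1) (b + 1) +
      chi J (a - 1) (b - 1) = 2 := by
  have hab := even_add_of_isPure (hpure _ h)
  have diag : ∀ s t, (s = a - 1 ∨ s = a + 1) → (t = b - 1 ∨ t = b + 1) →
      pt s t ∈ adjacency (pt a b) := by
    intro s t hs ht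
    exact pt_mem_adjacency_iff.2 (Or.inr (Or.inr ⟨hab, hs, ht⟩))
  have three : ∀ s₁ t₁ s₂ t₂ s₃ t₃, pt s₁ t₁ ∈ J → pt s₂ t₂ ∈ J → pt s₃ t₃ ∈ J →
      (s₁ = a - 1 ∨ s₁ = a + 1) → (t₁ = b - 1 ∨ t₁ = b + 1) →
      (s₂ = a - 1 ∨ s₂ = a + 1) → (t₂ = b - 1 ∨ t₂ = b + 1) →
      (s₃ = a - 1 ∨ s₃ = a + 1) → (t₃ = b - 1 ∨ t₃ = b + 1) →
      (s₁ = s₂ ∧ t₁ = t₂) ∨ (s₁ = s₃ ∧ t₁ = t₃) ∨ (s₂ = s₃ ∧ t₂ = t₃) := by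
    intro s₁ t₁ s₂ t₂ s₃ t₃ m₁ m₂ m₃ a₁ b₁ a₂ b₂ a₃ b₃
    simpa only [pt_inj] using hJ.eq_or_eq_of_mem_adjacency hcard h m₁ m₂ m₃ (diag _ _ a₁ b₁)
      (diag _ _ a₂ b₂) (diag _ _ a₃ b₃)
  have isDiag : ∀ c d, pt c d ∈ J → pt c d ∈ adjacency (pt a b) →
      (c = a - 1 ∨ c = a + 1) ∧ (d = b - 1 ∨ d = b + 1) := by
    intro c d hcd had
    have := even_add_of_isPure (hpure _ hcd)
    rw [pt_mem_adjacency_iff] at had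
    rw [Int.even_iff] at *
    omega
  obtain ⟨q, hq, r, hr, hne, hqp, hrp⟩ := hJ.exists_two_neighbors h
  obtain ⟨c, d, rfl⟩ := exists_eq_pt q
  obtain ⟨c', d', rfl⟩ := exists_eq_pt r
  rw [Ne, pt_inj] at hne
  have k₁ := isDiag _ _ hq hqp
  have k₂ := isDiag _ _ hr hrp
  by_cases hpp : pt (a + 1) (b + 1) ∈ J <;> by_cases hpm : pt (a + 1) (b - 1) ∈ J <;>
    by_cases hmp : pt (a - 1) (b + 1) ∈ J <;> by_cases hmm : pt (a - 1) (b - 1) ∈ J <;>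
    simp only [chi, hpp, hpm, hmp, hmm, if_true, if_false]
  all_goals exfalso
  all_goals first
    | (have := three _ _ _ _ _ _ hpp hpm hmp; omega)
    | (have := three _ _ _ _ _ _ hpp hpm hmm; omega)
    | (have := three _ _ _ _ _ _ hpp hmp hmm; omega)
    | (have := three _ _ _ _ _ _ hpm hmp hmm; omega)
    | (rcases k₁ with ⟨rfl | rfl, rfl | rfl⟩ <;> rcases k₂ with ⟨rfl | rfl, rfl | rfl⟩ <;>
        first | contradiction | omega)

end DigitalTopology

namespace DigitalTopology

open DigitalLine

/-! ### The complement near a pure Jordan curve -/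

theorem notMem_of_odd {J : Set DigitalPlane} (hpure : ∀ p ∈ J, IsPure p) {a b : ℤ}
    (h : Odd (a + b)) : pt a b ∉ J := fun hab =>
  Int.not_even_iff_odd.2 h (even_add_of_isPure (hpure _ hab))

theorem connectedComponentIn_compl_eq {J : Set DigitalPlane} {a b c d : ℤ} (h : pt a b ∉ J)
    (h' : pt c d ∉ J) (hadj : pt c d ∈ adjacency (pt a b)) :
    connectedComponentIn Jᶜ (pt a b) = connectedComponentIn Jᶜ (pt c d) :=
  connectedComponentIn_eq_of_mem_adjacency h h' hadj

/-- Any point off `J` adjacent to an end of an edge of `J` lies in the component of one of the two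
mixed points beside the edge. -/
theorem IsJordanCurve.component_eq_or_eq {J : Set DigitalPlane} (hJ : IsJordanCurve J)
    (hpure : ∀ p ∈ J, IsPure p) (hcard : 4 < J.encard) {a b s t c d : ℤ} (hs : s = 1 ∨ s = -1)
    (ht : t = 1 ∨ t = -1) (hp : pt a b ∈ J) (hq : pt (a + s) (b + t) ∈ J) (hcd : pt c d ∉ J)
    (hadj : pt c d ∈ adjacency (pt a b)) :
    connectedComponentIn Jᶜ (pt c d) = connectedComponentIn Jᶜ (pt (a + s) b) ∨
      connectedComponentIn Jᶜ (pt c d) = connectedComponentIn Jᶜ (pt a (b + t)) := by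
  have hab := Int.even_iff.1 (even_add_of_isPure (hpure _ hp))
  -- Besides the given edge, exactly one more leaves `(a, b)`.
  have hsum : chi J (a + s) (b - t) + chi J (a - s) (b + t) + chi J (a - s) (b - t) = 1 := by
    have h := hJ.sum_chi_eq_two hpure hcard hp
    have h' := chi_of_mem hq
    rcases hs with rfl | rfl <;> rcases ht with rfl | rfl <;>
      (try simp only [sub_neg_eq_add, ← sub_eq_add_neg] at h h' ⊢) <;> omega
  have n₁ : pt (a + s) b ∉ J := notMem_of_odd hpure (Int.odd_iff.2 (by omega))
  have n₂ : pt a (b + t) ∉ J := notMem_of_odd hpure (Int.odd_iff.2 (by omega))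
  have n₃ : pt (a - s) b ∉ J := notMem_of_odd hpure (Int.odd_iff.2 (by omega))
  have n₄ : pt a (b - t) ∉ J := notMem_of_odd hpure (Int.odd_iff.2 (by omega))
  -- A corner off `J` links the two mixed points next to it in the ring. With two of the other three
  -- corners off `J`, the ring falls into two chains.
  have corner : ∀ u v, (u = 1 ∨ u = -1) → (v = 1 ∨ v = -1) → pt (a + u) (b + v) ∉ J →
      connectedComponentIn Jᶜ (pt (a + u) (b + v)) = connectedComponentIn Jᶜ (pt (a + u) b) ∧
      connectedComponentIn Jᶜ (pt (a + u) (b + v)) = connectedComponentIn Jᶜ (pt a (b + v)) := by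
    intro u v hu hv huv
    exact ⟨connectedComponentIn_compl_eq huv
        (notMem_of_odd hpure (Int.odd_iff.2 (by omega))) (pt_mem_adjacency_iff.2 (by omega)),
      connectedComponentIn_compl_eq huv
        (notMem_of_odd hpure (Int.odd_iff.2 (by omega))) (pt_mem_adjacency_iff.2 (by omega))⟩
  have d₁ := corner s (-t) hs (by omega)
  have d₂ := corner (-s) t (by omega) ht
  have d₃ := corner (-s) (-t) (by omega) (by omega)
  simp only [← sub_eq_add_neg] at d₁ d₂ d₃
  have hc : c = a ∨ c = a + s ∨ c = a - s := by
    rw [pt_mem_adjacency_iff] at hadj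
    omega
  have hd : d = b ∨ d = b + t ∨ d = b - t := by
    rw [pt_mem_adjacency_iff] at hadj
    omega
  have hne : ¬ (c = a ∧ d = b) := fun h => hadj.1 (pt_inj.2 h)
  by_cases m₁ : pt (a + s) (b - t) ∈ J <;> by_cases m₂ : pt (a - s) (b + t) ∈ J <;>
    by_cases m₃ : pt (a - s) (b - t) ∈ J <;>
    simp only [chi, m₁, m₂, m₃, if_true, if_false] at hsum <;> try omega
  all_goals
    rcases hc with rfl | rfl | rfl <;> rcases hd with rfl | rfl | rfl <;> grind

theorem eq_connectedComponentIn_of_mem {X : Type*} [TopologicalSpace X] {S C : Set X}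
    (hC : C ∈ components S) {y : X} (hy : y ∈ C) : C = connectedComponentIn S y ∧ y ∈ S := by
  obtain ⟨x, -, rfl⟩ := hC
  exact ⟨connectedComponentIn_eq hy, connectedComponentIn_subset _ _ hy⟩

/-- The components adjacent to an end of an edge of `J` are those of the two mixed points beside
the edge. -/
theorem IsJordanCurve.adjacentToSet_iff {J : Set DigitalPlane} (hJ : IsJordanCurve J)
    (hpure : ∀ p ∈ J, IsPure p) (hcard : 4 < J.encard) {a b s t : ℤ} (hs : s = 1 ∨ s = -1)
    (ht : t = 1 ∨ t = -1) (hp : pt a b ∈ J) (hq : pt (a + s) (b + t) ∈ J)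
    {C : Set DigitalPlane} (hC : C ∈ components Jᶜ) :
    AdjacentToSet (pt a b) C ↔ C = connectedComponentIn Jᶜ (pt (a + s) b) ∨
      C = connectedComponentIn Jᶜ (pt a (b + t)) := by
  have hab := Int.even_iff.1 (even_add_of_isPure (hpure _ hp))
  constructor
  · rintro ⟨y, hyC, hy⟩
    obtain ⟨c, d, rfl⟩ := exists_eq_pt y
    obtain ⟨rfl, hcd⟩ := eq_connectedComponentIn_of_mem hC hyC
    exact hJ.component_eq_or_eq hpure hcard hs ht hp hq hcd hy
  · rintro (rfl | rfl)
    · exact ⟨_, mem_connectedComponentIn (notMem_of_odd hpure (Int.odd_iff.2 (by omega))),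
        pt_mem_adjacency_iff.2 (by omega)⟩
    · exact ⟨_, mem_connectedComponentIn (notMem_of_odd hpure (Int.odd_iff.2 (by omega))),
        pt_mem_adjacency_iff.2 (by omega)⟩

theorem adjacentToSet_iff_of_mem_adjacency {J : Set DigitalPlane} (hJ : IsJordanCurve J)
    (hpure : ∀ p ∈ J, IsPure p) (hcard : 4 < J.encard) {p q : DigitalPlane} (hp : p ∈ J)
    (hq : q ∈ J) (hpq : q ∈ adjacency p) {C : Set DigitalPlane} (hC : C ∈ components Jᶜ) :
    AdjacentToSet p C ↔ AdjacentToSet q C := by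
  obtain ⟨a, b, rfl⟩ := exists_eq_pt p
  obtain ⟨c, d, rfl⟩ := exists_eq_pt q
  have hab := Int.even_iff.1 (even_add_of_isPure (hpure _ hp))
  have hcd := Int.even_iff.1 (even_add_of_isPure (hpure _ hq))
  rw [pt_mem_adjacency_iff] at hpq
  obtain ⟨s, rfl⟩ : ∃ s, c = a + s := ⟨c - a, by omega⟩
  obtain ⟨t, rfl⟩ : ∃ t, d = b + t := ⟨d - b, by omega⟩
  have hs : s = 1 ∨ s = -1 := by omega
  have ht : t = 1 ∨ t = -1 := by omega
  -- Reversing the edge swaps its two mixed points.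
  rw [hJ.adjacentToSet_iff hpure hcard hs ht hp hq hC,
    hJ.adjacentToSet_iff hpure hcard (s := -s) (t := -t) (by omega) (by omega) hq
      (by simpa using hp) hC, add_neg_cancel_right, add_neg_cancel_right, or_comm]

theorem IsJordanCurve.adjacentToSet_iff_of_mem {J : Set DigitalPlane} (hJ : IsJordanCurve J)
    (hpure : ∀ p ∈ J, IsPure p) (hcard : 4 < J.encard) {p q : DigitalPlane} (hp : p ∈ J)
    (hq : q ∈ J) {C : Set DigitalPlane} (hC : C ∈ components Jᶜ) :
    AdjacentToSet p C ↔ AdjacentToSet q C := by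
  refine iff_of_isPreconnected (P := fun p => AdjacentToSet p C) hJ.isConnected.isPreconnected
    isOpen_minNhd self_mem_minNhd (fun x hx y hy hxy => ?_) hp hq
  by_cases hne : y = x
  · rw [hne]
  · exact adjacentToSet_iff_of_mem_adjacency hJ hpure hcard hx hy
      (mem_adjacency_iff.2 ⟨hne, Or.inl hxy⟩) hC

/-! ### Every component touches the curve -/

instance : PreconnectedSpace DigitalLine := by
  have step : ∀ n : ℤ, ofInt (n + 1) ∈ connectedComponent (ofInt n) := fun n =>
    ((mem_adjacency_digitalLine (m := n + 1) (n := n)).2 (Or.inr rfl)).2.isPreconnected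
      |>.subset_connectedComponent (by simp) (by simp)
  have all : ∀ n : ℤ, connectedComponent (ofInt n) = connectedComponent (ofInt 0) := by
    intro n
    induction n using Int.induction_on with
    | zero => rfl
    | succ k ih => rw [← connectedComponent_eq (step k), ih]
    | pred k ih =>
      rw [← ih, connectedComponent_eq (step (-k - 1)), sub_add_cancel]
  refine ⟨?_⟩
  have : (Set.univ : Set DigitalLine) = connectedComponent (ofInt 0) := by
    refine (Set.eq_univ_of_forall fun m => ?_).symm
    rw [← all (toInt m)]
    exact mem_connectedComponent
  rw [this]
  exact isPreconnected_connectedComponent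

/-- Every component of the complement of a nonempty set is adjacent to a point of the set. -/
theorem exists_adjacentToSet {J : Set DigitalPlane} (hJ : J.Nonempty) {C : Set DigitalPlane}
    (hC : C ∈ components Jᶜ) : ∃ p ∈ J, AdjacentToSet p C := by
  by_contra! hno
  obtain ⟨p, hp⟩ := hJ
  obtain ⟨x, hx, rfl⟩ := hC
  -- A component touching no point of `J` is closed under adjacency, so it would fill the plane.
  have hstep : ∀ u ∈ connectedComponentIn Jᶜ x, ∀ v, v ∈ adjacency u →
      v ∈ connectedComponentIn Jᶜ x := by
    intro u hu v huv
    have hv : v ∉ J := fun hv => hno v hv ⟨u, hu, adjacency_comm.1 huv⟩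
    rw [connectedComponentIn_eq hu,
      connectedComponentIn_eq_of_mem_adjacency (connectedComponentIn_subset _ _ hu) hv huv]
    exact mem_connectedComponentIn hv
  have := iff_of_isPreconnected (P := fun z => z ∈ connectedComponentIn Jᶜ x)
    (isPreconnected_univ (α := DigitalPlane)) isOpen_minNhd self_mem_minNhd
    (fun u _ v _ huv => by
      by_cases hne : v = u
      · rw [hne]
      · have h := mem_adjacency_iff.2 ⟨hne, Or.inl huv⟩
        exact ⟨fun hu => hstep u hu v h, fun hv => hstep v hv u (adjacency_comm.1 h)⟩)
    (Set.mem_univ x) (Set.mem_univ p)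
  exact connectedComponentIn_subset _ _ (this.1 (mem_connectedComponentIn hx)) hp

/-! ### The parity function -/

/-- A finitely supported function on the lattice is a difference along the diagonal. -/
theorem exists_diagonal_primitive {G : Type*} [AddCommGroup G] (e : ℤ → ℤ → G) (M : ℤ)
    (he : ∀ x y, M ≤ x → e x y = 0) :
    ∃ φ : ℤ → ℤ → G, (∀ x y, M ≤ x → φ x y = 0) ∧
      ∀ x y, φ x y = e x y + φ (x + 1) (y + 1) := by
  -- Sum `e` along the diagonal up to column `M`; `toNat` makes the sum empty beyond it.
  refine ⟨fun x y => ∑ k ∈ Finset.range (M - x).toNat, e (x + k) (y + k), fun x y hx => ?_,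
    fun x y => ?_⟩
  · simp [Int.toNat_of_nonpos (sub_nonpos.2 hx)]
  · rcases le_or_gt M x with hx | hx
    · simp [Int.toNat_of_nonpos (sub_nonpos.2 hx),
        Int.toNat_of_nonpos (show M - (x + 1) ≤ 0 by omega), he x y hx]
    · beta_reduce
      rw [show (M - x).toNat = (M - (x + 1)).toNat + 1 by omega, Finset.sum_range_succ', add_comm]
      simp only [Nat.cast_zero, add_zero, Nat.cast_add, Nat.cast_one]
      congr 1
      exact Finset.sum_congr rfl fun k _ => by congr 1 <;> ring

theorem exists_bound {J : Set DigitalPlane} (hJ : J.Finite) :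
    ∃ M : ℤ, ∀ x y, M ≤ x → pt x y ∉ J := by
  obtain ⟨M, hM⟩ := (hJ.image fun p => toInt p.1).bddAbove
  refine ⟨M + 1, fun x y hx h => ?_⟩
  have : x ≤ M := hM ⟨pt x y, h, rfl⟩
  omega

/-- A mod 2 function that changes across the edges of `J` and across nothing else. -/
theorem IsJordanCurve.exists_parity {J : Set DigitalPlane} (hJ : IsJordanCurve J)
    (hpure : ∀ p ∈ J, IsPure p) (hcard : 4 < J.encard) : ∃ φ : ℤ → ℤ → ZMod 2,
      (∀ x y, φ x y = chi J (x + 1) y * chi J x (y + 1) + φ (x + 1) (y + 1)) ∧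
      ∀ x y, φ x y = chi J x (y - 1) * chi J (x + 1) y + φ (x + 1) (y - 1) := by
  obtain ⟨M, hM⟩ := exists_bound hJ.finite
  obtain ⟨φ, hφ₀, hφ⟩ := exists_diagonal_primitive
    (fun x y => (chi J (x + 1) y * chi J x (y + 1) : ZMod 2)) M
    (fun x y hx => by simp [chi_of_notMem (hM x (y + 1) hx)])
  refine ⟨φ, hφ, ?_⟩
  have hdeg : ∀ a b, (chi J a b : ZMod 2) * (chi J (a + 1) (b + 1) + chi J (a + 1) (b - 1) +
      chi J (a - 1) (b + 1) + chi J (a - 1) (b - 1)) = 0 := by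
    intro a b
    by_cases h : pt a b ∈ J
    · have := congrArg (Nat.cast : ℕ → ZMod 2) (hJ.sum_chi_eq_two hpure hcard h)
      push_cast at this
      rw [this]
      exact mul_eq_zero_of_right _ rfl
    · simp [chi_of_notMem h]
  -- The rule holds trivially from column `M` on and propagates leftwards: the four mixed points
  -- around `(x + 1, y)` form a cycle crossing the edges at that point, an even number by `hdeg`.
  have main : ∀ n : ℕ, ∀ x y, M - n ≤ x →
      φ x y = chi J x (y - 1) * chi J (x + 1) y + φ (x + 1) (y - 1) := by
    intro n
    induction n with
    | zero =>
      intro x y hx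
      have hx' : M ≤ x := by simpa using hx
      rw [hφ₀ x y hx', hφ₀ (x + 1) _ (by omega), chi_of_notMem (hM x (y - 1) hx')]
      simp
    | succ n ih =>
      intro x y hx
      push_cast at hx
      have h₁ := ih (x + 1) (y + 1) (by omega)
      have h₂ := hφ x y
      have h₃ := hφ (x + 1) (y - 1)
      have h₄ := hdeg (x + 1) y
      simp only [add_sub_cancel_right, sub_add_cancel] at h₁ h₂ h₃ h₄
      have two : (2 : ZMod 2) = 0 := rfl
      linear_combination h₁ + h₂ - h₃ + h₄ -
        (chi J (x + 1) y * (chi J x (y - 1) + chi J (x + 1 + 1) (y - 1))) * two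
  exact fun x y => main (M - x).toNat x y (by omega)

/-- The extension to all points of a function on the mixed points. -/
def extend (φ : ℤ → ℤ → ZMod 2) (p : DigitalPlane) : ZMod 2 :=
  if Even (toInt p.1 + toInt p.2) then φ (toInt p.1 + 1) (toInt p.2) else φ (toInt p.1) (toInt p.2)

theorem extend_of_even (φ : ℤ → ℤ → ZMod 2) {a b : ℤ} (h : Even (a + b)) :
    extend φ (pt a b) = φ (a + 1) b := if_pos h

theorem extend_of_odd (φ : ℤ → ℤ → ZMod 2) {a b : ℤ} (h : Odd (a + b)) :
    extend φ (pt a b) = φ a b := if_neg (Int.not_even_iff_odd.2 h)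

/-- No edge of `J` ends at a point off `J`, so `φ` does not change around it and the choice of `a +
1` in `extend` is immaterial. -/
theorem extend_eq_of_notMem {J : Set DigitalPlane} {φ : ℤ → ℤ → ZMod 2}
    (h₁ : ∀ x y, φ x y = chi J (x + 1) y * chi J x (y + 1) + φ (x + 1) (y + 1))
    (h₂ : ∀ x y, φ x y = chi J x (y - 1) * chi J (x + 1) y + φ (x + 1) (y - 1)) {a b : ℤ}
    (hab : Even (a + b)) (h : pt a b ∉ J) :
    φ (a + 1) b = extend φ (pt a b) ∧ φ (a - 1) b = extend φ (pt a b) ∧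
      φ a (b + 1) = extend φ (pt a b) ∧ φ a (b - 1) = extend φ (pt a b) := by
  rw [extend_of_even φ hab]
  have k₁ := h₁ a (b - 1)
  have k₂ := h₁ (a - 1) b
  have k₃ := h₂ (a - 1) b
  simp only [sub_add_cancel, chi_of_notMem h, Nat.cast_zero, mul_zero, zero_mul, zero_add]
    at k₁ k₂ k₃
  exact ⟨rfl, k₃.trans k₁, k₂.symm.trans (k₃.trans k₁), k₁⟩

/-- Of two adjacent points at least one is pure, and two adjacent pure points off `J` share a mixed
neighbour, or else the second point is itself a mixed neighbour of the first. -/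
theorem extend_eq_of_mem_adjacency {J : Set DigitalPlane} {φ : ℤ → ℤ → ZMod 2}
    (h₁ : ∀ x y, φ x y = chi J (x + 1) y * chi J x (y + 1) + φ (x + 1) (y + 1))
    (h₂ : ∀ x y, φ x y = chi J x (y - 1) * chi J (x + 1) y + φ (x + 1) (y - 1))
    {p q : DigitalPlane} (hp : p ∉ J) (hq : q ∉ J) (h : q ∈ adjacency p) :
    extend φ p = extend φ q := by
  wlog hpp : Even (toInt p.1 + toInt p.2) generalizing p q
  · refine (this hq hp (adjacency_comm.1 h) ?_).symm
    obtain ⟨a, b, rfl⟩ := exists_eq_pt p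
    obtain ⟨c, d, rfl⟩ := exists_eq_pt q
    change ¬ Even (a + b) at hpp
    change Even (c + d)
    rw [pt_mem_adjacency_iff] at h
    rw [Int.even_iff] at *
    omega
  obtain ⟨a, b, rfl⟩ := exists_eq_pt p
  obtain ⟨c, d, rfl⟩ := exists_eq_pt q
  replace hpp : Even (a + b) := hpp
  obtain ⟨e₁, e₂, e₃, e₄⟩ := extend_eq_of_notMem h₁ h₂ hpp hp
  rw [pt_mem_adjacency_iff] at h
  rcases Int.even_or_odd (c + d) with hcd | hcd
  · obtain ⟨f₁, f₂, f₃, f₄⟩ := extend_eq_of_notMem h₁ h₂ hcd hq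
    have hc : c = a - 1 ∨ c = a + 1 := by
      rw [Int.even_iff] at *
      omega
    have hd : d = b - 1 ∨ d = b + 1 := by
      rw [Int.even_iff] at *
      omega
    rcases hc with rfl | rfl <;> rcases hd with rfl | rfl <;>
      simp only [sub_add_cancel, add_sub_cancel_right] at f₁ f₂ f₃ f₄
    · rw [← e₄, f₁]
    · rw [← e₃, f₁]
    · rw [← e₄, f₂]
    · rw [← e₃, f₂]
  · rw [extend_of_odd φ hcd]
    have : (c = a ∧ (d = b - 1 ∨ d = b + 1)) ∨ (d = b ∧ (c = a - 1 ∨ c = a + 1)) := by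
      rw [Int.odd_iff] at hcd
      rw [Int.even_iff] at *
      omega
    rcases this with ⟨rfl, rfl | rfl⟩ | ⟨rfl, rfl | rfl⟩
    · exact e₄.symm
    · exact e₃.symm
    · exact e₂.symm
    · exact e₁.symm

/-- The two mixed points beside an edge of `J` lie in different components. -/
theorem IsJordanCurve.component_ne {J : Set DigitalPlane} (hJ : IsJordanCurve J)
    (hpure : ∀ p ∈ J, IsPure p) (hcard : 4 < J.encard) {a b s t : ℤ} (hs : s = 1 ∨ s = -1)
    (ht : t = 1 ∨ t = -1) (hp : pt a b ∈ J) (hq : pt (a + s) (b + t) ∈ J) :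
    connectedComponentIn Jᶜ (pt (a + s) b) ≠ connectedComponentIn Jᶜ (pt a (b + t)) := by
  obtain ⟨φ, h₁, h₂⟩ := hJ.exists_parity hpure hcard
  have hab := Int.even_iff.1 (even_add_of_isPure (hpure _ hp))
  have o₁ : Odd (a + s + b) := Int.odd_iff.2 (by omega)
  have o₂ : Odd (a + (b + t)) := Int.odd_iff.2 (by omega)
  intro heq
  have m₁ : pt (a + s) b ∈ connectedComponentIn Jᶜ (pt (a + s) b) :=
    mem_connectedComponentIn (notMem_of_odd hpure o₁)
  have m₂ : pt a (b + t) ∈ connectedComponentIn Jᶜ (pt (a + s) b) :=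
    heq ▸ mem_connectedComponentIn (notMem_of_odd hpure o₂)
  have key := iff_of_isPreconnected (P := fun z => extend φ z = extend φ (pt (a + s) b))
    isPreconnected_connectedComponentIn isOpen_minNhd self_mem_minNhd
    (fun u hu v hv huv => by
      by_cases hne : v = u
      · rw [hne]
      · rw [extend_eq_of_mem_adjacency h₁ h₂ (connectedComponentIn_subset _ _ hu)
          (connectedComponentIn_subset _ _ hv) (mem_adjacency_iff.2 ⟨hne, Or.inl huv⟩)]) m₁ m₂
  have hφ := key.1 rfl
  rw [extend_of_odd φ o₁, extend_of_odd φ o₂] at hφ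
  -- In each direction, one of the two rules crosses this very edge and makes the values differ by
  -- 1.
  rcases hs with rfl | rfl <;> rcases ht with rfl | rfl <;>
    try simp only [← sub_eq_add_neg] at hq hφ
  · have := h₂ a (b + 1)
    simp [chi_of_mem hp, chi_of_mem hq, hφ] at this
  · have := h₁ a (b - 1)
    simp [chi_of_mem hp, chi_of_mem hq, hφ] at this
  · have := h₁ (a - 1) b
    simp [chi_of_mem hp, chi_of_mem hq, hφ] at this
  · have := h₂ (a - 1) b
    simp [chi_of_mem hp, chi_of_mem hq, hφ] at this

end DigitalTopology

open DigitalTopology in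
theorem mainTheorem5 (J : Set DigitalPlane) (hJ : DigitalTopology.IsJordanCurve J)
    (hpure : ∀ p ∈ J, DigitalTopology.IsPure p) (hcard : 4 < J.encard) :
    (DigitalTopology.components Jᶜ).encard = 2 ∧
      ∀ p ∈ J, ∀ C ∈ DigitalTopology.components Jᶜ, DigitalTopology.AdjacentToSet p C := by
  have hadj : ∀ p ∈ J, ∀ C ∈ components Jᶜ, AdjacentToSet p C := by
    intro p hp C hC
    obtain ⟨q, hq, hqC⟩ := exists_adjacentToSet hJ.isConnected.nonempty hC
    exact (hJ.adjacentToSet_iff_of_mem hpure hcard hp hq hC).2 hqC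
  refine ⟨?_, hadj⟩
  obtain ⟨p, hp⟩ := hJ.isConnected.nonempty
  obtain ⟨q, hq, -, -, -, hqp, -⟩ := hJ.exists_two_neighbors hp
  obtain ⟨a, b, rfl⟩ := exists_eq_pt p
  obtain ⟨c, d, rfl⟩ := exists_eq_pt q
  have hab := Int.even_iff.1 (even_add_of_isPure (hpure _ hp))
  have hcd := Int.even_iff.1 (even_add_of_isPure (hpure _ hq))
  rw [pt_mem_adjacency_iff] at hqp
  obtain ⟨s, rfl⟩ : ∃ s, c = a + s := ⟨c - a, by omega⟩
  obtain ⟨t, rfl⟩ : ∃ t, d = b + t := ⟨d - b, by omega⟩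
  have hs : s = 1 ∨ s = -1 := by omega
  have ht : t = 1 ∨ t = -1 := by omega
  have hcomp : components Jᶜ = {connectedComponentIn Jᶜ (pt (a + s) b),
      connectedComponentIn Jᶜ (pt a (b + t))} := by
    ext C
    constructor
    · intro hC
      exact (hJ.adjacentToSet_iff hpure hcard hs ht hp hq hC).1 (hadj _ hp C hC)
    · rintro (rfl | rfl)
      · exact ⟨_, notMem_of_odd hpure (Int.odd_iff.2 (by omega)), rfl⟩
      · exact ⟨_, notMem_of_odd hpure (Int.odd_iff.2 (by omega)), rfl⟩
  rw [hcomp]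
  exact Set.encard_pair (hJ.component_ne hpure hcard hs ht hp hq)
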